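/- Let $N\ge 1$ and $L\ge 0$ be integers and $\sigma>0$. For a Hermitian positive definite $C\in\mathbb C^{n\times n}$ and $m\in\mathbb C^n$ write $$\mathcal N_{\mathbb C}(x;m,C)=\frac{1}{\pi^n\det C}\exp\bigl(-(x-m)^{\mathrm H}C^{-1}(x-m)\bigr),\qquad x\in\mathbb C^n,$$ for the circularly symmetric complex Gaussian density. Let $p$ be a continuous probability density on $\mathbb C^N$ which vanishes at infinity, and let $y=h+n$, where $h$ has density $p$ and $n\sim\mathcal N_{\mathbb C}(0,\sigma^2 I)$ is independent of $h$. The conditional mean (MSE-optimal) estimator is $$\hat h_{\mathrm{CME}}(y)=\mathrm E[h\mid y]=\int_{\mathbb C^N} h\,p(h\mid y)\,dh,\qquad p(h\mid y)=\frac{\mathcal N_{\mathbb C}(y;h,\sigma^2I)\,p(h)}{\int_{\mathbb C^N}\mathcal N_{\mathbb C}(y;h',\sigma^2I)\,p(h')\,dh'}.$$ A mixture of $K\ge1$ factor analyzers (MFA) with $L$ latent dimensions is given by weights $p(k)\ge 0$ with $\sum_{k=1}^K p(k)=1$, means $\mu_k\in\mathbb C^N$, factor loading matrices $W_k\in\mathbb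 C^{N\times L}$ and diagonal positive definite matrices $\Psi_k\in\mathbb R^{N\times N}$, $k=1,\dots,K$. Its density is $$p^{(K,L)}(h)=\sum_{k=1}^K\int_{\mathbb C^L}\mathcal N_{\mathbb C}(h;\mu_k+W_kz,\Psi_k)\,\mathcal N_{\mathbb C}(z;0,I)\,p(k)\,dz .$$ With $C_k=W_kW_k^{\mathrm H}+\Psi_k$, the MFA-based estimator is the responsibility-weighted convex combination of LMMSE estimates $$\hat h^{(K,L)}(y)=\sum_{k=1}^K p(k\mid y)\Bigl(\mu_k+C_k(C_k+\sigma^2I)^{-1}(y-\mu_k)\Bigr),\qquad p(k\mid y)=\frac{p(k)\,\mathcal N_{\mathbb C}(y;\mu_k,C_k+\sigma^2I)}{\sum_{i=1}^K p(i)\,\mathcal N_{\mathbb C}(y;\mu_i,C_i+\sigma^2I)} .$$ Then, for every number $L$ of latent dimensions: (i) for every $y\in\mathbb C^N$ the estimator $\hat h_{\mathrm{CME}}(y)$ is well defined: the density of the observation is positive at $y$ and $h\mapsto h\,p(h\mid y)$ is integrable; (ii) there is a sequence of MFAs, the $K$th one having $K$ components and $L$ latent dimensions, such that $\lim_{K\to\infty}\|p-p^{(K,L)}\|_\infty=0$;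 (iii) for every sequence of MFAs as in (ii), and for every $y\in\mathbb C^N$, $$\lim_{K\to\infty}\bigl\|\hat h_{\mathrm{CME}}(y)-\hat h^{(K,L)}(y)\bigr\|=0 .$$ -/

import Mathlib

open Filter Topology MeasureTheory
open scoped Matrix

noncomputable section

/-- Density at `x` of the circularly symmetric complex Gaussian distribution on `ℂⁿ` with mean `m`
and (Hermitian positive definite) covariance matrix `C`, with respect to Lebesgue measure:
`exp (-(x - m)ᴴ C⁻¹ (x - m)) / (πⁿ det C)`. -/
def complexGaussianPDF {n : ℕ} (m : Fin n → ℂ) (C : Matrix (Fin n) (Fin n) ℂ)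
    (x : Fin n → ℂ) : ℝ :=
  Real.exp (-(star (x - m) ⬝ᵥ (C⁻¹ *ᵥ (x - m))).re) / (Real.pi ^ n * C.det.re)

/-- Covariance `σ² I` of the noise. -/
def noiseCov (N : ℕ) (σ : ℝ) : Matrix (Fin N) (Fin N) ℂ := ((σ ^ 2 : ℝ) : ℂ) • 1

/-- Density `p(y)` of the observation `y = h + n`, where `h` has density `p` and
`n ∼ 𝒩_ℂ(0, σ² I)` is independent of `h`. -/
def observationPDF {N : ℕ} (σ : ℝ) (p : (Fin N → ℂ) → ℝ) (y : Fin N → ℂ) : ℝ :=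
  ∫ h : Fin N → ℂ, complexGaussianPDF h (noiseCov N σ) y * p h

/-- Conditional density `p(h | y) = p(y | h) p(h) / p(y)`. -/
def posteriorPDF {N : ℕ} (σ : ℝ) (p : (Fin N → ℂ) → ℝ) (y h : Fin N → ℂ) : ℝ :=
  complexGaussianPDF h (noiseCov N σ) y * p h / observationPDF σ p y

/-- The conditional mean estimator `E[h | y] = ∫ h p(h | y) dh`. -/
def conditionalMean {N : ℕ} (σ : ℝ) (p : (Fin N → ℂ) → ℝ) (y : Fin N → ℂ) : Fin N → ℂ :=
  ∫ h : Fin N → ℂ, posteriorPDF σ p y h • h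

/-- Parameters of a mixture of `K` factor analyzers on `ℂᴺ` with `L` latent dimensions. -/
structure MFA (N L K : ℕ) where
  /-- mixing weights `p(k)` -/
  weight : Fin K → ℝ
  /-- means `μ_k` -/
  mean : Fin K → (Fin N → ℂ)
  /-- factor loading matrices `W_k` -/
  loading : Fin K → Matrix (Fin N) (Fin L) ℂ
  /-- diagonal entries of the covariances `Ψ_k` -/
  uniqueness : Fin K → (Fin N → ℝ)
  weight_nonneg : ∀ k, 0 ≤ weight k
  weight_sum : ∑ k, weight k = 1
  uniqueness_pos : ∀ k i, 0 < uniqueness k i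

namespace MFA

variable {N L K : ℕ}

/-- The diagonal covariance matrix `Ψ_k`. -/
def diagCov (M : MFA N L K) (k : Fin K) : Matrix (Fin N) (Fin N) ℂ :=
  Matrix.diagonal fun i => (M.uniqueness k i : ℂ)

/-- The density `p^{(K,L)}(h) = ∑ₖ ∫ p(h | z, k) p(z) p(k) dz` with `z ∼ 𝒩_ℂ(0, I)` on `ℂᴸ` and
`h | z, k ∼ 𝒩_ℂ(μ_k + W_k z, Ψ_k)`. -/
def density (M : MFA N L K) (h : Fin N → ℂ) : ℝ :=
  ∑ k, ∫ z : Fin L → ℂ,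
    complexGaussianPDF (M.mean k + M.loading k *ᵥ z) (M.diagCov k) h
      * complexGaussianPDF 0 1 z * M.weight k

/-- The covariance matrix `W_k W_kᴴ + Ψ_k` of the `k`th component. -/
def cov (M : MFA N L K) (k : Fin K) : Matrix (Fin N) (Fin N) ℂ :=
  M.loading k * (M.loading k)ᴴ + M.diagCov k

/-- The LMMSE estimate of the `k`th component. -/
def lmmse (M : MFA N L K) (σ : ℝ) (y : Fin N → ℂ) (k : Fin K) : Fin N → ℂ :=
  M.mean k + (M.cov k * (M.cov k + noiseCov N σ)⁻¹) *ᵥ (y - M.mean k)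

/-- The responsibility `p(k | y)` of the `k`th component for the observation `y`. -/
def responsibility (M : MFA N L K) (σ : ℝ) (y : Fin N → ℂ) (k : Fin K) : ℝ :=
  M.weight k * complexGaussianPDF (M.mean k) (M.cov k + noiseCov N σ) y
    / ∑ i, M.weight i * complexGaussianPDF (M.mean i) (M.cov i + noiseCov N σ) y

/-- The MFA-based estimator. -/
def estimator (M : MFA N L K) (σ : ℝ) (y : Fin N → ℂ) : Fin N → ℂ :=
  ∑ k, M.responsibility σ y k • M.lmmse σ y k

end MFA

end

/-! For fixed `y` the conditional mean is a quotient of two integrals of the prior against the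
Gaussian likelihood. The likelihood has integrable zeroth and first moments, so only boundedness of
the prior is needed and `p` itself may lack a mean. Hence the quotient is well defined, and it is
continuous in the prior for uniform convergence, by dominated convergence
(`tendsto_conditionalMean_of_tendstoUniformly`).

The MFA estimator is exactly the conditional mean for the prior `M.density`
(`MFA.estimator_eq_conditionalMean`): completing the square turns each Gaussian component times the
likelihood into a constant times a Gaussian centred at the LMMSE estimate. Convergence of the
estimators is therefore this continuity.

For the approximation, `p` is the uniform limit of its convolutions with narrowing Gaussians. Each
convolution is an average of translated Gaussians, taken in the space of bounded continuous
functions, so it lies in the closed convex hull of isotropic Gaussians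
(`mem_closure_convexHull_isotropicGaussians`). Finite mixtures of these are MFAs with zero loadings,
whatever `L` is. -/

open scoped ComplexOrder BoundedContinuousFunction

/-! ### Elementary properties of the complex Gaussian density -/

theorem Matrix.PosDef.det_re_pos {n : ℕ} {C : Matrix (Fin n) (Fin n) ℂ} (hC : C.PosDef) :
    0 < C.det.re := (Complex.pos_iff.1 hC.det_pos).1

theorem Matrix.PosDef.det_eq_ofReal {n : ℕ} {C : Matrix (Fin n) (Fin n) ℂ} (hC : C.PosDef) :
    C.det = (C.det.re : ℂ) :=
  Complex.ext rfl (by simpa using (Complex.pos_iff.1 hC.det_pos).2.symm)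

theorem complexGaussianPDF_nonneg {n : ℕ} {m : Fin n → ℂ} {C : Matrix (Fin n) (Fin n) ℂ}
    (hC : C.PosDef) (x : Fin n → ℂ) : 0 ≤ complexGaussianPDF m C x := by
  have := hC.det_re_pos
  unfold complexGaussianPDF
  positivity

theorem complexGaussianPDF_pos {n : ℕ} {m : Fin n → ℂ} {C : Matrix (Fin n) (Fin n) ℂ}
    (hC : C.PosDef) (x : Fin n → ℂ) : 0 < complexGaussianPDF m C x := by
  have := hC.det_re_pos
  unfold complexGaussianPDF
  positivity

theorem complexGaussianPDF_le {n : ℕ} {m : Fin n → ℂ} {C : Matrix (Fin n) (Fin n) ℂ}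
    (hC : C.PosDef) (x : Fin n → ℂ) :
    complexGaussianPDF m C x ≤ 1 / (Real.pi ^ n * C.det.re) := by
  have := hC.det_re_pos
  unfold complexGaussianPDF
  gcongr
  rw [Real.exp_le_one_iff, neg_nonpos]
  exact hC.inv.posSemidef.re_dotProduct_nonneg _

theorem continuous_complexGaussianPDF {α : Type*} [TopologicalSpace α] {n : ℕ}
    {f g : α → Fin n → ℂ} (hf : Continuous f) (C : Matrix (Fin n) (Fin n) ℂ) (hg : Continuous g) :
    Continuous fun a => complexGaussianPDF (f a) C (g a) := by
  unfold complexGaussianPDF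
  have h : Continuous fun a => g a - f a := hg.sub hf
  have : Continuous fun a => star (g a - f a) ⬝ᵥ (C⁻¹ *ᵥ (g a - f a)) :=
    h.star.dotProduct (continuous_const.matrix_mulVec h)
  fun_prop

theorem complexGaussianPDF_sub_left {n : ℕ} (m a x : Fin n → ℂ) (C : Matrix (Fin n) (Fin n) ℂ) :
    complexGaussianPDF m C (x - a) = complexGaussianPDF (m + a) C x := by
  unfold complexGaussianPDF
  rw [show x - a - m = x - (m + a) by abel]

theorem complexGaussianPDF_eq_zero_mean {n : ℕ} (m x : Fin n → ℂ) (C : Matrix (Fin n) (Fin n) ℂ) :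
    complexGaussianPDF m C x = complexGaussianPDF 0 C (x - m) := by
  simp [complexGaussianPDF]

theorem complexGaussianPDF_neg {n : ℕ} (x : Fin n → ℂ) (C : Matrix (Fin n) (Fin n) ℂ) :
    complexGaussianPDF 0 C (-x) = complexGaussianPDF 0 C x := by
  simp [complexGaussianPDF, Matrix.mulVec_neg]

/-! ### Completing the square in a linear Gaussian model -/

section Completion

variable {n m : ℕ} {A : Matrix (Fin n) (Fin m) ℂ} {R : Matrix (Fin n) (Fin n) ℂ}
  {P : Matrix (Fin m) (Fin m) ℂ}

theorem posDef_mul_mul_conjTranspose_add (hR : R.PosDef) (hP : P.PosDef) :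
    (A * P * Aᴴ + R).PosDef :=
  hR.posSemidef_add (hP.posSemidef.mul_mul_conjTranspose_same A)

theorem posDef_inv_add_conjTranspose_mul_mul (hR : R.PosDef) (hP : P.PosDef) :
    (P⁻¹ + Aᴴ * R⁻¹ * A).PosDef :=
  hP.inv.add_posSemidef (hR.inv.posSemidef.conjTranspose_mul_mul_same A)

/-- With `S = A P Aᴴ + R`, substituting `y = S v` and `z = w + P Aᴴ v` removes `S⁻¹` and reduces the
residual `y - A z` to `R v - A w`; the rest is expansion. -/
theorem complete_square (hR : R.PosDef) (hP : P.PosDef) (y : Fin n → ℂ) (z : Fin m → ℂ) :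
    star (y - A *ᵥ z) ⬝ᵥ (R⁻¹ *ᵥ (y - A *ᵥ z)) + star z ⬝ᵥ (P⁻¹ *ᵥ z)
      = star y ⬝ᵥ ((A * P * Aᴴ + R)⁻¹ *ᵥ y)
        + star (z - (P * Aᴴ * (A * P * Aᴴ + R)⁻¹) *ᵥ y) ⬝ᵥ ((P⁻¹ + Aᴴ * R⁻¹ * A) *ᵥ
            (z - (P * Aᴴ * (A * P * Aᴴ + R)⁻¹) *ᵥ y)) := by
  have hS := posDef_mul_mul_conjTranspose_add (A := A) hR hP
  obtain ⟨v, rfl⟩ : ∃ v, y = (A * P * Aᴴ + R) *ᵥ v := ⟨(A * P * Aᴴ + R)⁻¹ *ᵥ y, by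
    rw [Matrix.mulVec_mulVec, Matrix.mul_nonsing_inv _ ((Matrix.isUnit_iff_isUnit_det _).1 hS.isUnit),
      Matrix.one_mulVec]⟩
  have h1 : (A * P * Aᴴ + R)⁻¹ *ᵥ ((A * P * Aᴴ + R) *ᵥ v) = v := by
    rw [Matrix.mulVec_mulVec, Matrix.nonsing_inv_mul _ ((Matrix.isUnit_iff_isUnit_det _).1 hS.isUnit),
      Matrix.one_mulVec]
  have hRR : ∀ u, R⁻¹ *ᵥ (R *ᵥ u) = u := fun u => by
    rw [Matrix.mulVec_mulVec, Matrix.nonsing_inv_mul _ ((Matrix.isUnit_iff_isUnit_det _).1 hR.isUnit),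
      Matrix.one_mulVec]
  have hPP : ∀ u, P⁻¹ *ᵥ (P *ᵥ u) = u := fun u => by
    rw [Matrix.mulVec_mulVec, Matrix.nonsing_inv_mul _ ((Matrix.isUnit_iff_isUnit_det _).1 hP.isUnit),
      Matrix.one_mulVec]
  have hRs : ∀ u w, star (R *ᵥ u) ⬝ᵥ w = star u ⬝ᵥ (R *ᵥ w) := fun u w => by
    rw [Matrix.star_mulVec, hR.isHermitian.eq, ← Matrix.dotProduct_mulVec]
  have hPs : ∀ u w, star (P *ᵥ u) ⬝ᵥ w = star u ⬝ᵥ (P *ᵥ w) := fun u w => by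
    rw [Matrix.star_mulVec, hP.isHermitian.eq, ← Matrix.dotProduct_mulVec]
  have hPs' : ∀ u, P *ᵥ (P⁻¹ *ᵥ u) = u := fun u => by
    rw [Matrix.mulVec_mulVec, Matrix.mul_nonsing_inv _ ((Matrix.isUnit_iff_isUnit_det _).1 hP.isUnit),
      Matrix.one_mulVec]
  have hRs' : ∀ u, R *ᵥ (R⁻¹ *ᵥ u) = u := fun u => by
    rw [Matrix.mulVec_mulVec, Matrix.mul_nonsing_inv _ ((Matrix.isUnit_iff_isUnit_det _).1 hR.isUnit),
      Matrix.one_mulVec]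
  have hAs : ∀ u w, star (A *ᵥ u) ⬝ᵥ w = star u ⬝ᵥ (Aᴴ *ᵥ w) := fun u w => by
    rw [Matrix.star_mulVec, ← Matrix.dotProduct_mulVec]
  have hAs' : ∀ u w, star (Aᴴ *ᵥ u) ⬝ᵥ w = star u ⬝ᵥ (A *ᵥ w) := fun u w => by
    rw [Matrix.star_mulVec, Matrix.conjTranspose_conjTranspose, ← Matrix.dotProduct_mulVec]
  obtain ⟨w, rfl⟩ : ∃ w, z = w + P *ᵥ (Aᴴ *ᵥ v) := ⟨z - P *ᵥ (Aᴴ *ᵥ v), by simp⟩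
  rw [← Matrix.mulVec_mulVec _ (P * Aᴴ), h1]
  have h2 : (A * P * Aᴴ + R) *ᵥ v - A *ᵥ (w + P *ᵥ (Aᴴ *ᵥ v)) = R *ᵥ v - A *ᵥ w := by
    simp only [Matrix.add_mulVec, Matrix.mulVec_add, ← Matrix.mulVec_mulVec]
    abel
  rw [h2]
  simp only [← Matrix.mulVec_mulVec, add_sub_cancel_right, Matrix.add_mulVec, Matrix.mulVec_add,
    Matrix.mulVec_sub, star_add, star_sub, sub_dotProduct, dotProduct_sub, add_dotProduct,
    dotProduct_add, hRs, hPs, hRR, hPP, hAs, hAs', hRs', hPs']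
  ring

theorem det_mul_det_inv_add (hR : R.PosDef) (hP : P.PosDef) :
    R.det * P.det * (P⁻¹ + Aᴴ * R⁻¹ * A).det = (A * P * Aᴴ + R).det := by
  have hPu := (Matrix.isUnit_iff_isUnit_det _).1 hP.isUnit
  have h : P⁻¹ + Aᴴ * R⁻¹ * A = (1 + Aᴴ * R⁻¹ * (A * P)) * P⁻¹ := by
    rw [Matrix.add_mul, Matrix.one_mul, Matrix.mul_assoc _ (A * P), Matrix.mul_assoc A,
      Matrix.mul_nonsing_inv _ hPu, Matrix.mul_one]
  have hd : P.det * (P⁻¹).det = 1 := by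
    rw [← Matrix.det_mul, Matrix.mul_nonsing_inv _ hPu, Matrix.det_one]
  rw [add_comm (A * P * Aᴴ) R,
    Matrix.det_add_mul _ _ ((Matrix.isUnit_iff_isUnit_det _).1 hR.isUnit), h, Matrix.det_mul]
  linear_combination R.det * (1 + Aᴴ * R⁻¹ * (A * P)).det * hd

/-- Joint density as marginal of `y` times posterior of `z`. It is used with `A = W_k`, `P = 1` to
integrate out the latent variable, and with `A = 1` for Bayes' rule. -/
theorem complexGaussianPDF_mul (hR : R.PosDef) (hP : P.PosDef) (y : Fin n → ℂ) (z : Fin m → ℂ) :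
    complexGaussianPDF (A *ᵥ z) R y * complexGaussianPDF 0 P z
      = complexGaussianPDF 0 (A * P * Aᴴ + R) y
        * complexGaussianPDF ((P * Aᴴ * (A * P * Aᴴ + R)⁻¹) *ᵥ y) (P⁻¹ + Aᴴ * R⁻¹ * A)⁻¹ z := by
  have hS := posDef_mul_mul_conjTranspose_add (A := A) hR hP
  have hT := posDef_inv_add_conjTranspose_mul_mul (A := A) hR hP
  have hTi : ((P⁻¹ + Aᴴ * R⁻¹ * A)⁻¹)⁻¹ = P⁻¹ + Aᴴ * R⁻¹ * A :=
    Matrix.nonsing_inv_nonsing_inv _ ((Matrix.isUnit_iff_isUnit_det _).1 hT.isUnit)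
  have hd : R.det.re * P.det.re = (A * P * Aᴴ + R).det.re * ((P⁻¹ + Aᴴ * R⁻¹ * A)⁻¹).det.re := by
    have h := det_mul_det_inv_add (A := A) hR hP
    have hTd : ((P⁻¹ + Aᴴ * R⁻¹ * A)⁻¹).det * (P⁻¹ + Aᴴ * R⁻¹ * A).det = 1 := by
      rw [← Matrix.det_mul, Matrix.nonsing_inv_mul _ ((Matrix.isUnit_iff_isUnit_det _).1 hT.isUnit),
        Matrix.det_one]
    have : R.det * P.det = (A * P * Aᴴ + R).det * ((P⁻¹ + Aᴴ * R⁻¹ * A)⁻¹).det := by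
      rw [← h]
      linear_combination - R.det * P.det * hTd
    rw [hR.det_eq_ofReal, hP.det_eq_ofReal, hS.det_eq_ofReal, hT.inv.det_eq_ofReal] at this
    exact_mod_cast this
  have hq := congrArg Complex.re (complete_square (A := A) hR hP y z)
  rw [Complex.add_re, Complex.add_re] at hq
  unfold complexGaussianPDF
  rw [div_mul_div_comm, div_mul_div_comm, ← Real.exp_add, ← Real.exp_add, hTi, sub_zero, sub_zero]
  congr 1
  · congr 1
    linarith
  · linear_combination Real.pi ^ n * Real.pi ^ m * hd

end Completion

/-! ### Total mass and mean of a complex Gaussian -/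

theorem re_star_dotProduct_self {n : ℕ} (z : Fin n → ℂ) :
    (star z ⬝ᵥ z).re = ∑ i, ‖z i‖ ^ 2 := by
  simp [dotProduct, Complex.normSq_apply, Complex.sq_norm]

theorem integral_exp_neg_re_star_dotProduct_self (n : ℕ) :
    ∫ z : Fin n → ℂ, Real.exp (-(star z ⬝ᵥ z).re) = Real.pi ^ n := by
  have h := GaussianFourier.integral_rexp_neg_mul_sq_norm (V := ℂ) one_pos
  simp only [div_one, Complex.finrank_real_complex, Nat.cast_ofNat] at h
  rw [div_self two_ne_zero, Real.rpow_one] at h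
  simp_rw [re_star_dotProduct_self, ← Finset.sum_neg_distrib, Real.exp_sum]
  rw [integral_fintype_prod_volume_eq_pow fun x : ℂ => Real.exp (-‖x‖ ^ 2)]
  simpa using congrArg (· ^ n) h

/-- The determinant of a complex matrix seen as a real-linear map is `|det X|²`, hence `normSq` in
the Jacobian. -/
theorem integral_comp_mulVec {n : ℕ} (X : Matrix (Fin n) (Fin n) ℂ) (hX : X.det ≠ 0)
    {f : (Fin n → ℂ) → ℝ} (hf : Continuous f) :
    ∫ z, f (X *ᵥ z) = (Complex.normSq X.det)⁻¹ * ∫ z, f z := by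
  have hdet : LinearMap.det ((Matrix.toLin' X).restrictScalars ℝ) = Complex.normSq X.det := by
    rw [LinearMap.det_restrictScalars, Algebra.norm_complex_apply, LinearMap.det_toLin']
  have hne : LinearMap.det ((Matrix.toLin' X).restrictScalars ℝ) ≠ 0 := by
    rw [hdet]; simpa using hX
  have h := Measure.map_linearMap_addHaar_eq_smul_addHaar (volume : Measure (Fin n → ℂ)) hne
  have hc : Continuous ((Matrix.toLin' X).restrictScalars ℝ) :=
    LinearMap.continuous_of_finiteDimensional _
  have h2 := integral_map (μ := volume) hc.measurable.aemeasurable (f := f) hf.aestronglyMeasurable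
  rw [h, integral_smul_measure, hdet] at h2
  rw [show ∫ z, f (X *ᵥ z) = ∫ z, f (((Matrix.toLin' X).restrictScalars ℝ) z) from rfl, ← h2,
    abs_of_nonneg (inv_nonneg.2 (Complex.normSq_nonneg _)),
    ENNReal.toReal_ofReal (inv_nonneg.2 (Complex.normSq_nonneg _)), smul_eq_mul]

open scoped MatrixOrder Matrix.Norms.L2Operator in
theorem integral_complexGaussianPDF {n : ℕ} (m : Fin n → ℂ) {C : Matrix (Fin n) (Fin n) ℂ}
    (hC : C.PosDef) : ∫ x, complexGaussianPDF m C x = 1 := by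
  simp_rw [complexGaussianPDF_eq_zero_mean m]
  rw [integral_sub_right_eq_self (fun x => complexGaussianPDF 0 C x) m]
  have hCu := (Matrix.isUnit_iff_isUnit_det _).1 hC.isUnit
  -- The factorisation `C⁻¹ = Xᴴ X` reduces the quadratic form to the standard one in the variable
  -- `X z`.
  obtain ⟨X, hX⟩ : ∃ X : Matrix (Fin n) (Fin n) ℂ, C⁻¹ = Xᴴ * X :=
    CStarAlgebra.nonneg_iff_eq_star_mul_self.1 hC.inv.posSemidef.nonneg
  have hd : Complex.normSq X.det * C.det.re = 1 := by
    have : (C⁻¹).det * C.det = 1 := by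
      rw [← Matrix.det_mul, Matrix.nonsing_inv_mul _ hCu, Matrix.det_one]
    rw [hX, Matrix.det_mul, Matrix.det_conjTranspose, hC.det_eq_ofReal] at this
    rw [← Complex.ofReal_inj, Complex.ofReal_mul, Complex.normSq_eq_conj_mul_self]
    simpa using this
  have hXd : X.det ≠ 0 := by
    intro h
    simp [h] at hd
  have hq : ∀ z : Fin n → ℂ, star z ⬝ᵥ (C⁻¹ *ᵥ z) = star (X *ᵥ z) ⬝ᵥ (X *ᵥ z) := fun z => by
    rw [hX, ← Matrix.mulVec_mulVec, Matrix.star_mulVec, ← Matrix.dotProduct_mulVec]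
  have hc : Continuous fun z : Fin n → ℂ => Real.exp (-(star z ⬝ᵥ z).re) := by
    have : Continuous fun z : Fin n → ℂ => star z ⬝ᵥ z := continuous_star.dotProduct continuous_id
    fun_prop
  unfold complexGaussianPDF
  simp only [sub_zero, hq]
  rw [integral_div, integral_comp_mulVec X hXd hc, integral_exp_neg_re_star_dotProduct_self]
  have := hC.det_re_pos
  have := Real.pi_pos
  field_simp
  rw [eq_comm, ← hd]
  have := Complex.normSq_pos.2 hXd
  field_simp

theorem integrable_complexGaussianPDF {n : ℕ} (m : Fin n → ℂ) {C : Matrix (Fin n) (Fin n) ℂ}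
    (hC : C.PosDef) : Integrable fun x => complexGaussianPDF m C x :=
  integrable_of_integral_eq_one (integral_complexGaussianPDF m hC)

/-- The mean of a complex Gaussian density is its location parameter. -/
theorem integral_complexGaussianPDF_smul {n : ℕ} (m : Fin n → ℂ) {C : Matrix (Fin n) (Fin n) ℂ}
    (hC : C.PosDef) (hi : Integrable fun x => complexGaussianPDF m C x • x) :
    ∫ x, complexGaussianPDF m C x • x = m := by
  have h0 : ∫ x, complexGaussianPDF m C x • (x - m) = 0 := by
    simp_rw [complexGaussianPDF_eq_zero_mean m]
    rw [integral_sub_right_eq_self (fun x => complexGaussianPDF 0 C x • x) m]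
    -- The centred integrand is odd, so its integral equals its own negative.
    have h := integral_neg_eq_self (fun x : Fin n → ℂ => complexGaussianPDF 0 C x • x) volume
    simp only [complexGaussianPDF_neg, smul_neg, integral_neg] at h
    exact self_eq_neg.1 h.symm
  simp_rw [smul_sub] at h0
  rw [integral_sub hi ((integrable_complexGaussianPDF m hC).smul_const m), integral_smul_const,
    integral_complexGaussianPDF m hC, one_smul, sub_eq_zero] at h0
  exact h0

/-! ### Isotropic Gaussians and their first moments -/

theorem posDef_noiseCov (N : ℕ) {σ : ℝ} (hσ : 0 < σ) : (noiseCov N σ).PosDef := by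
  have h : (0 : ℂ) < ((σ ^ 2 : ℝ) : ℂ) := by
    rw [Complex.zero_lt_real]; positivity
  exact Matrix.PosDef.one.smul h

theorem complexGaussianPDF_noiseCov {N : ℕ} {σ : ℝ} (hσ : 0 < σ) (m x : Fin N → ℂ) :
    complexGaussianPDF m (noiseCov N σ) x =
      Real.exp (-(σ ^ 2)⁻¹ * ∑ i, ‖x i - m i‖ ^ 2) / (Real.pi ^ N * (σ ^ 2) ^ N) := by
  have hinv : (noiseCov N σ)⁻¹ = (((σ ^ 2)⁻¹ : ℝ) : ℂ) • 1 := by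
    apply Matrix.inv_eq_right_inv
    rw [noiseCov, Matrix.smul_mul, Matrix.one_mul, smul_smul, ← Complex.ofReal_mul,
      mul_inv_cancel₀ (by positivity), Complex.ofReal_one, one_smul]
  have hdet : (noiseCov N σ).det.re = (σ ^ 2) ^ N := by
    rw [noiseCov, Matrix.det_smul, Matrix.det_one, mul_one, Fintype.card_fin, ← Complex.ofReal_pow,
      Complex.ofReal_re]
  rw [complexGaussianPDF, hinv, hdet, Matrix.smul_mulVec, Matrix.one_mulVec, dotProduct_smul,
    smul_eq_mul, Complex.re_ofReal_mul, re_star_dotProduct_self]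
  simp

theorem complexGaussianPDF_noiseCov_comm {N : ℕ} {σ : ℝ} (hσ : 0 < σ) (m x : Fin N → ℂ) :
    complexGaussianPDF m (noiseCov N σ) x = complexGaussianPDF x (noiseCov N σ) m := by
  simp_rw [complexGaussianPDF_noiseCov hσ, norm_sub_rev]

theorem complexGaussianPDF_noiseCov_eq_scale {N : ℕ} {s : ℝ} (hs : 0 < s) (u : Fin N → ℂ) :
    complexGaussianPDF 0 (noiseCov N s) (s • u) = (s ^ 2)⁻¹ ^ N * complexGaussianPDF 0 1 u := by
  have h1 : (1 : Matrix (Fin N) (Fin N) ℂ) = noiseCov N 1 := by simp [noiseCov]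
  rw [h1, complexGaussianPDF_noiseCov hs, complexGaussianPDF_noiseCov one_pos]
  have h : (s ^ 2)⁻¹ * ∑ i, ‖(s • u) i - (0 : Fin N → ℂ) i‖ ^ 2
      = (1 ^ 2)⁻¹ * ∑ i, ‖u i - (0 : Fin N → ℂ) i‖ ^ 2 := by
    simp only [Pi.smul_apply, Pi.zero_apply, sub_zero, norm_smul, mul_pow, ← Finset.mul_sum,
      Real.norm_eq_abs, sq_abs]
    field_simp
  rw [neg_mul, neg_mul, h, one_pow, one_pow, mul_one, inv_pow]
  field_simp

/-- The density of the noise, multiplied by the norm, is dominated by a multiple of a Gaussian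
density of larger variance. -/
theorem exists_norm_mul_complexGaussianPDF_le (N : ℕ) {σ : ℝ} (hσ : 0 < σ) :
    ∃ c : ℝ, ∀ x : Fin N → ℂ, ‖x‖ * complexGaussianPDF 0 (noiseCov N σ) x
      ≤ c * complexGaussianPDF 0 (noiseCov N (2 * σ)) x := by
  have hb : 0 < (σ ^ 2)⁻¹ - ((2 * σ) ^ 2)⁻¹ := by
    rw [sub_pos]
    gcongr
    linarith
  set b := (σ ^ 2)⁻¹ - ((2 * σ) ^ 2)⁻¹ with hb_def
  -- Here `4 ^ N` is the ratio of the two normalising constants, and `1 + 1 / b` comes from `‖x‖ ≤ 1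
  -- + ‖x‖²` and `1 + b ‖x‖² ≤ exp (b S)`.
  refine ⟨(1 + 1 / b) * 4 ^ N, fun x => ?_⟩
  rw [complexGaussianPDF_noiseCov hσ, complexGaussianPDF_noiseCov (by positivity)]
  simp only [Pi.zero_apply, sub_zero]
  set S := ∑ i, ‖x i‖ ^ 2 with hS
  have hxS : ‖x‖ ^ 2 ≤ S := by
    have h0 : 0 ≤ S := by positivity
    have : ‖x‖ ≤ √S := (pi_norm_le_iff_of_nonneg (Real.sqrt_nonneg _)).2 fun i =>
      Real.le_sqrt_of_sq_le
        (Finset.single_le_sum (f := fun i => ‖x i‖ ^ 2) (fun _ _ => by positivity) (Finset.mem_univ i))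
    calc ‖x‖ ^ 2 ≤ √S ^ 2 := by gcongr
      _ = S := Real.sq_sqrt h0
  have hx : ‖x‖ ≤ (1 + 1 / b) * Real.exp (b * S) := by
    have h1 : 1 + b * ‖x‖ ^ 2 ≤ Real.exp (b * S) := by
      have := Real.add_one_le_exp (b * S)
      nlinarith
    calc ‖x‖ ≤ 1 + ‖x‖ ^ 2 := by nlinarith [sq_nonneg (‖x‖ - 1)]
      _ = 1 * 1 + 1 / b * (b * ‖x‖ ^ 2) := by field_simp
      _ ≤ (1 + 1 / b) * (1 + b * ‖x‖ ^ 2) := by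
        have : 0 ≤ 1 / b := by positivity
        have : 0 ≤ b * ‖x‖ ^ 2 := by positivity
        nlinarith
      _ ≤ _ := by gcongr
  have hexp : Real.exp (-((2 * σ) ^ 2)⁻¹ * S)
      = Real.exp (b * S) * Real.exp (-(σ ^ 2)⁻¹ * S) := by
    rw [← Real.exp_add]
    congr 1
    rw [hb_def]
    ring
  have h4 : ((2 * σ) ^ 2) ^ N = 4 ^ N * (σ ^ 2) ^ N := by
    rw [← mul_pow]
    ring
  have hπ := Real.pi_pos
  rw [hexp, h4]
  calc ‖x‖ * (Real.exp (-(σ ^ 2)⁻¹ * S) / (Real.pi ^ N * (σ ^ 2) ^ N))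
      ≤ ((1 + 1 / b) * Real.exp (b * S))
        * (Real.exp (-(σ ^ 2)⁻¹ * S) / (Real.pi ^ N * (σ ^ 2) ^ N)) := by gcongr
    _ = _ := by field_simp

theorem complexGaussianPDF_noiseCov_swap {N : ℕ} {σ : ℝ} (hσ : 0 < σ) (y h : Fin N → ℂ) :
    complexGaussianPDF h (noiseCov N σ) y = complexGaussianPDF 0 (noiseCov N σ) (h - y) := by
  rw [complexGaussianPDF_noiseCov_comm hσ, complexGaussianPDF_eq_zero_mean]

theorem integrable_complexGaussianPDF_noiseCov {N : ℕ} {σ : ℝ} (hσ : 0 < σ) (y : Fin N → ℂ) :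
    Integrable fun h : Fin N → ℂ => complexGaussianPDF h (noiseCov N σ) y := by
  simp_rw [complexGaussianPDF_noiseCov_comm hσ _ y]
  exact integrable_complexGaussianPDF y (posDef_noiseCov N hσ)

theorem integrable_complexGaussianPDF_noiseCov_smul {N : ℕ} {σ : ℝ} (hσ : 0 < σ)
    (y : Fin N → ℂ) :
    Integrable fun h : Fin N → ℂ => complexGaussianPDF h (noiseCov N σ) y • h := by
  have h0 : Integrable fun h : Fin N → ℂ => complexGaussianPDF 0 (noiseCov N σ) h • h := by
    obtain ⟨c, hc⟩ := exists_norm_mul_complexGaussianPDF_le N hσ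
    refine ((integrable_complexGaussianPDF 0 (posDef_noiseCov N
      (by positivity : 0 < 2 * σ))).const_mul c).mono' ?_ (.of_forall fun x => ?_)
    · have : Continuous fun h : Fin N → ℂ => complexGaussianPDF 0 (noiseCov N σ) h :=
        continuous_complexGaussianPDF continuous_const _ continuous_id
      exact (this.smul continuous_id).aestronglyMeasurable
    · rw [norm_smul, Real.norm_of_nonneg (complexGaussianPDF_nonneg (posDef_noiseCov N hσ) _),
        mul_comm]
      exact hc x
  have h1 := (h0.comp_sub_right y).add ((integrable_complexGaussianPDF_noiseCov hσ y).smul_const y)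
  refine h1.congr (.of_forall fun h => ?_)
  simp only [Pi.add_apply, complexGaussianPDF_noiseCov_swap hσ y h]
  rw [← smul_add, sub_add_cancel]

/-! ### The MFA density as a finite Gaussian mixture -/

namespace MFA

variable {N L K : ℕ}

theorem posDef_diagCov (M : MFA N L K) (k : Fin K) : (M.diagCov k).PosDef :=
  Matrix.PosDef.diagonal fun i => by simpa using M.uniqueness_pos k i

theorem posDef_cov (M : MFA N L K) (k : Fin K) : (M.cov k).PosDef :=
  (M.posDef_diagCov k).posSemidef_add (Matrix.posSemidef_self_mul_conjTranspose _)

/-- After `complexGaussianPDF_mul`, the latent `z` occurs only in a Gaussian factor of total mass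
one. -/
theorem density_eq (M : MFA N L K) (h : Fin N → ℂ) :
    M.density h = ∑ k, M.weight k * complexGaussianPDF (M.mean k) (M.cov k) h := by
  unfold density
  congr! 1 with k
  have hΨ := M.posDef_diagCov k
  have hT := (posDef_inv_add_conjTranspose_mul_mul (A := M.loading k) hΨ Matrix.PosDef.one).inv
  have h1 : ∀ z, complexGaussianPDF (M.mean k + M.loading k *ᵥ z) (M.diagCov k) h
      * complexGaussianPDF 0 1 z
      = complexGaussianPDF (M.mean k) (M.cov k) h * complexGaussianPDF _ _ z := fun z => by
    rw [add_comm, ← complexGaussianPDF_sub_left,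
      complexGaussianPDF_mul (A := M.loading k) hΨ Matrix.PosDef.one,
      complexGaussianPDF_sub_left, zero_add, Matrix.mul_one, ← cov]
  simp_rw [h1]
  rw [integral_mul_const, integral_const_mul, integral_complexGaussianPDF _ hT]
  ring

theorem continuous_density (M : MFA N L K) : Continuous M.density := by
  rw [funext M.density_eq]
  exact continuous_finsetSum _ fun k _ =>
    continuous_const.mul (continuous_complexGaussianPDF continuous_const _ continuous_id)

end MFA

/-- Bayes' rule for a Gaussian prior and Gaussian noise: the posterior is Gaussian, and its mean is
the LMMSE estimate. -/
theorem exists_posDef_complexGaussianPDF_mul {N : ℕ} {R C : Matrix (Fin N) (Fin N) ℂ}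
    (hR : R.PosDef) (hC : C.PosDef) (μ y : Fin N → ℂ) :
    ∃ T : Matrix (Fin N) (Fin N) ℂ, T.PosDef ∧ ∀ h,
      complexGaussianPDF h R y * complexGaussianPDF μ C h
        = complexGaussianPDF μ (C + R) y
          * complexGaussianPDF (μ + (C * (C + R)⁻¹) *ᵥ (y - μ)) T h := by
  refine ⟨_, (posDef_inv_add_conjTranspose_mul_mul (A := 1) hR hC).inv, fun h => ?_⟩
  have key := complexGaussianPDF_mul (A := 1) hR hC (y - μ) (h - μ)
  simp only [Matrix.one_mulVec, Matrix.one_mul, Matrix.conjTranspose_one, Matrix.mul_one] at key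
  rw [complexGaussianPDF_sub_left, complexGaussianPDF_sub_left, complexGaussianPDF_sub_left,
    complexGaussianPDF_sub_left, sub_add_cancel, zero_add, add_comm (_ *ᵥ _)] at key
  simpa using key

/-! ### Conditional means for bounded continuous priors -/

section Bounded

variable {N : ℕ} {σ : ℝ} {q : (Fin N → ℂ) → ℝ}

theorem integrable_noise_mul (hσ : 0 < σ) (hq : Continuous q) {B : ℝ} (hB : ∀ h, |q h| ≤ B)
    (y : Fin N → ℂ) :
    Integrable fun h : Fin N → ℂ => complexGaussianPDF h (noiseCov N σ) y * q h :=
  (integrable_complexGaussianPDF_noiseCov hσ y).mul_bdd (c := B) hq.aestronglyMeasurable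
    (.of_forall hB)

theorem integrable_noise_mul_smul (hσ : 0 < σ) (hq : Continuous q) {B : ℝ} (hB : ∀ h, |q h| ≤ B)
    (y : Fin N → ℂ) :
    Integrable fun h : Fin N → ℂ => (complexGaussianPDF h (noiseCov N σ) y * q h) • h := by
  have := (integrable_complexGaussianPDF_noiseCov_smul hσ y).bdd_smul (φ := q) B
    hq.aestronglyMeasurable (.of_forall hB)
  refine this.congr (.of_forall fun h => ?_)
  rw [Pi.smul_apply', smul_smul, mul_comm]

theorem conditionalMean_eq (σ : ℝ) (q : (Fin N → ℂ) → ℝ) (y : Fin N → ℂ) :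
    conditionalMean σ q y = (observationPDF σ q y)⁻¹ •
      ∫ h : Fin N → ℂ, (complexGaussianPDF h (noiseCov N σ) y * q h) • h := by
  unfold conditionalMean posteriorPDF
  simp_rw [div_eq_inv_mul, mul_smul]
  rw [integral_smul]

/-- The likelihood is strictly positive, so a vanishing integral would force `q = 0` almost
everywhere. -/
theorem observationPDF_pos (hσ : 0 < σ) (hq : Continuous q) {B : ℝ} (hB : ∀ h, |q h| ≤ B)
    (hq0 : ∀ h, 0 ≤ q h) (hq1 : ∫ h, q h ≠ 0) (y : Fin N → ℂ) : 0 < observationPDF σ q y := by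
  have hpos := fun h => complexGaussianPDF_pos (m := h) (posDef_noiseCov N hσ) y
  have hnn : ∀ h : Fin N → ℂ, 0 ≤ complexGaussianPDF h (noiseCov N σ) y * q h :=
    fun h => mul_nonneg (hpos h).le (hq0 h)
  refine (integral_nonneg hnn).lt_of_ne' fun h0 => hq1 ?_
  rw [integral_eq_zero_iff_of_nonneg hnn (integrable_noise_mul hσ hq hB y)] at h0
  refine integral_eq_zero_of_ae (h0.mono fun h hh => ?_)
  simpa [(hpos h).ne'] using hh

theorem tendsto_conditionalMean_of_tendstoUniformly {ι : Type*} {l : Filter ι}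
    [l.IsCountablyGenerated] {Q : ι → (Fin N → ℂ) → ℝ} (hσ : 0 < σ)
    (hQ : ∀ i, Continuous (Q i)) {B : ℝ} (hB : ∀ h, |q h| ≤ B)
    (hlim : TendstoUniformly Q q l) (y : Fin N → ℂ) (hy : observationPDF σ q y ≠ 0) :
    Tendsto (fun i => conditionalMean σ (Q i) y) l (𝓝 (conditionalMean σ q y)) := by
  -- Uniform convergence gives an eventual common bound, so fixed multiples of the likelihood and of
  -- its first-moment integrand dominate the two integrals.
  have hbd : ∀ᶠ i in l, ∀ h, |Q i h| ≤ B + 1 := by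
    filter_upwards [Metric.tendstoUniformly_iff.1 hlim 1 one_pos] with i hi h
    have h1 := hi h
    have h2 := hB h
    rw [Real.dist_eq, abs_sub_comm] at h1
    have := abs_sub_abs_le_abs_sub (Q i h) (q h)
    linarith
  have hg := continuous_complexGaussianPDF (n := N) continuous_id (noiseCov N σ)
    (continuous_const (y := y))
  simp only [id] at hg
  have hgn : ∀ h : Fin N → ℂ, 0 ≤ complexGaussianPDF h (noiseCov N σ) y :=
    fun h => complexGaussianPDF_nonneg (posDef_noiseCov N hσ) y
  simp_rw [conditionalMean_eq]
  refine Tendsto.smul (Tendsto.inv₀ ?_ hy) ?_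
  · refine tendsto_integral_filter_of_dominated_convergence
      (fun h => complexGaussianPDF h (noiseCov N σ) y * (B + 1)) ?_ ?_ ?_ ?_
    · exact .of_forall fun i => (hg.mul (hQ i)).aestronglyMeasurable
    · filter_upwards [hbd] with i hi
      refine .of_forall fun h => ?_
      rw [norm_mul, Real.norm_of_nonneg (hgn h)]
      exact mul_le_mul_of_nonneg_left (hi h) (hgn h)
    · exact (integrable_complexGaussianPDF_noiseCov hσ y).mul_const _
    · exact .of_forall fun h => (hlim.tendsto_at h).const_mul _
  · refine tendsto_integral_filter_of_dominated_convergence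
      (fun h => (B + 1) * ‖complexGaussianPDF h (noiseCov N σ) y • h‖) ?_ ?_ ?_ ?_
    · exact .of_forall fun i => ((hg.mul (hQ i)).smul continuous_id).aestronglyMeasurable
    · filter_upwards [hbd] with i hi
      refine .of_forall fun h => ?_
      rw [mul_comm, mul_smul, norm_smul]
      exact mul_le_mul_of_nonneg_right (hi h) (norm_nonneg _)
    · exact (integrable_complexGaussianPDF_noiseCov_smul hσ y).norm.const_mul _
    · exact .of_forall fun h => ((hlim.tendsto_at h).const_mul _).smul_const _

end Bounded

/-! ### The MFA estimator as an exact conditional mean -/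

namespace MFA

variable {N L K : ℕ}

theorem estimator_eq_conditionalMean (M : MFA N L K) {σ : ℝ} (hσ : 0 < σ) (y : Fin N → ℂ) :
    M.estimator σ y = conditionalMean σ M.density y := by
  have hR := posDef_noiseCov N hσ
  choose T hT hprod using fun k =>
    exists_posDef_complexGaussianPDF_mul hR (M.posDef_cov k) (M.mean k) y
  have hcont : ∀ k, Continuous (complexGaussianPDF (M.mean k) (M.cov k)) := fun k =>
    continuous_complexGaussianPDF continuous_const _ continuous_id
  have hbd : ∀ k h, |complexGaussianPDF (M.mean k) (M.cov k) h|
      ≤ 1 / (Real.pi ^ N * (M.cov k).det.re) := fun k h => by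
    rw [abs_of_nonneg (complexGaussianPDF_nonneg (M.posDef_cov k) h)]
    exact complexGaussianPDF_le (M.posDef_cov k) h
  have hpos : ∀ k, 0 < complexGaussianPDF (M.mean k) (M.cov k + noiseCov N σ) y := fun k =>
    complexGaussianPDF_pos ((M.posDef_cov k).add hR) y
  have hobs : observationPDF σ M.density y
      = ∑ k, M.weight k * complexGaussianPDF (M.mean k) (M.cov k + noiseCov N σ) y := by
    unfold observationPDF
    simp_rw [M.density_eq, Finset.mul_sum, mul_left_comm _ (M.weight _)]
    rw [integral_finsetSum _ fun k _ =>
      (integrable_noise_mul hσ (hcont k) (hbd k) y).const_mul _]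
    congr! 1 with k
    simp_rw [hprod]
    rw [integral_const_mul, integral_const_mul, integral_complexGaussianPDF _ (hT k), mul_one]
  have hmean : ∫ h : Fin N → ℂ, (complexGaussianPDF h (noiseCov N σ) y * M.density h) • h
      = ∑ k, (M.weight k * complexGaussianPDF (M.mean k) (M.cov k + noiseCov N σ) y)
          • M.lmmse σ y k := by
    simp_rw [M.density_eq, Finset.mul_sum, mul_left_comm _ (M.weight _), Finset.sum_smul,
      mul_smul (M.weight _)]
    rw [integral_finsetSum _ fun k _ =>
      (integrable_noise_mul_smul hσ (hcont k) (hbd k) y).fun_smul (M.weight k)]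
    congr! 1 with k
    have hi := integrable_noise_mul_smul hσ (hcont k) (hbd k) y
    simp_rw [hprod, mul_smul] at hi ⊢
    rw [integral_smul, integral_smul, integral_complexGaussianPDF_smul _ (hT k), lmmse]
    -- First moments of the posterior Gaussian are inherited from the likelihood, by cancelling the
    -- nonzero constant in front.
    exact (integrable_smul_iff (hpos k).ne' _).1 hi
  rw [conditionalMean_eq, hobs, hmean, estimator, Finset.smul_sum]
  congr! 1 with k
  rw [responsibility, div_eq_inv_mul, mul_smul]

end MFA

/-! ### Uniform approximation by isotropic Gaussian mixtures -/

theorem tendsto_complexGaussianPDF_noiseCov_cocompact {N : ℕ} {s : ℝ} (hs : 0 < s) :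
    Tendsto (fun x : Fin N → ℂ => complexGaussianPDF 0 (noiseCov N s) x)
      (cocompact (Fin N → ℂ)) (𝓝 0) := by
  obtain ⟨c, hc⟩ := exists_norm_mul_complexGaussianPDF_le N hs
  have h2 := posDef_noiseCov N (by positivity : 0 < 2 * s)
  have hn : Tendsto (fun x : Fin N → ℂ => ‖x‖) (cocompact _) atTop := tendsto_norm_cocompact_atTop
  have hlim := (tendsto_inv_atTop_zero.comp hn).const_mul
    (|c| * (1 / (Real.pi ^ N * (noiseCov N (2 * s)).det.re)))
  rw [mul_zero] at hlim
  refine tendsto_of_tendsto_of_tendsto_of_le_of_le' tendsto_const_nhds hlim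
    (.of_forall fun x => complexGaussianPDF_nonneg (posDef_noiseCov N hs) x) ?_
  filter_upwards [hn.eventually_gt_atTop 0] with x hx
  rw [Function.comp_apply, ← div_eq_mul_inv, le_div_iff₀ hx, mul_comm]
  calc _ ≤ c * complexGaussianPDF 0 (noiseCov N (2 * s)) x := hc x
    _ ≤ |c| * complexGaussianPDF 0 (noiseCov N (2 * s)) x := by
      gcongr
      · exact complexGaussianPDF_nonneg h2 x
      · exact le_abs_self c
    _ ≤ _ := by
      gcongr
      exact complexGaussianPDF_le h2 x

/-- The translate `x ↦ f (x - u)` of a bounded continuous function. -/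
def BoundedContinuousFunction.translate {E : Type*} [NormedAddCommGroup E] (f : E →ᵇ ℝ) (u : E) :
    E →ᵇ ℝ :=
  f.compContinuous ⟨fun x => x - u, by fun_prop⟩

theorem BoundedContinuousFunction.translate_apply {E : Type*} [NormedAddCommGroup E] (f : E →ᵇ ℝ)
    (u x : E) : f.translate u x = f (x - u) := rfl

theorem BoundedContinuousFunction.norm_translate_le {E : Type*} [NormedAddCommGroup E]
    (f : E →ᵇ ℝ) (u : E) : ‖f.translate u‖ ≤ ‖f‖ :=
  (BoundedContinuousFunction.norm_le (norm_nonneg _)).2 fun x => f.norm_coe_le_norm (x - u)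

/-- Uniform continuity is what makes translation continuous in the sup norm; it lets integrals of
translates be taken in the space of bounded continuous functions. -/
theorem BoundedContinuousFunction.continuous_translate {E : Type*} [NormedAddCommGroup E]
    {f : E →ᵇ ℝ} (hf : UniformContinuous f) : Continuous f.translate := by
  refine Metric.continuous_iff.2 fun b ε hε => ?_
  obtain ⟨δ, hδ, h⟩ := Metric.uniformContinuous_iff.1 hf (ε / 2) (half_pos hε)
  refine ⟨δ, hδ, fun a ha => lt_of_le_of_lt ?_ (half_lt_self hε)⟩
  refine (BoundedContinuousFunction.dist_le (half_pos hε).le).2 fun x => (h ?_).le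
  change dist (x - a) (x - b) < δ
  rwa [dist_sub_left]

theorem exists_bound_of_tendsto_cocompact {E : Type*} [TopologicalSpace E] {p : E → ℝ}
    (hp : Continuous p) (h0 : Tendsto p (cocompact E) (𝓝 0)) : ∃ B, ∀ x, |p x| ≤ B := by
  let f : ZeroAtInftyContinuousMap E ℝ := ⟨⟨p, hp⟩, h0⟩
  exact ⟨‖f.toBCF‖, fun x => f.toBCF.norm_coe_le_norm x⟩

/-- The isotropic complex Gaussian densities, as bounded continuous functions. -/
def isotropicGaussians (N : ℕ) : Set ((Fin N → ℂ) →ᵇ ℝ) :=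
  {f | ∃ s : ℝ, 0 < s ∧ ∃ μ : Fin N → ℂ, ∀ x, f x = complexGaussianPDF μ (noiseCov N s) x}

/-- The convolution of a probability density with an isotropic Gaussian density is a limit of
finite Gaussian mixtures. -/
theorem integral_translate_mem_closure {N : ℕ} {p : (Fin N → ℂ) →ᵇ ℝ}
    (hp : UniformContinuous p) (hp0 : ∀ x, 0 ≤ p x) (hp1 : ∫ x, p x = 1) {s : ℝ} (hs : 0 < s) :
    ∫ u : Fin N → ℂ, complexGaussianPDF 0 1 u • p.translate (s • u)
      ∈ closure (convexHull ℝ (isotropicGaussians N)) := by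
  have hpi : Integrable fun x => p x := integrable_of_integral_eq_one hp1
  have hgc : Continuous fun x : Fin N → ℂ => complexGaussianPDF 0 (noiseCov N s) x :=
    continuous_complexGaussianPDF continuous_const _ continuous_id
  have hg0 := tendsto_complexGaussianPDF_noiseCov_cocompact (N := N) hs
  obtain ⟨B, hB⟩ := exists_bound_of_tendsto_cocompact hgc hg0
  let g : (Fin N → ℂ) →ᵇ ℝ := BoundedContinuousFunction.ofNormedAddCommGroup _ hgc B hB
  have hgu : UniformContinuous g := hgc.uniformContinuous_of_tendsto_cocompact hg0
  have hgt := BoundedContinuousFunction.continuous_translate hgu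
  have hpt := BoundedContinuousFunction.continuous_translate hp
  -- The convolution is the `ν`-average of translates of `g`; a closed convex set contains the
  -- average of a probability measure carried by it.
  let ν : Measure (Fin N → ℂ) := volume.withDensity fun x => ENNReal.ofReal (p x)
  have hν : IsProbabilityMeasure ν := ⟨by
    rw [withDensity_apply _ MeasurableSet.univ, Measure.restrict_univ,
      ← ofReal_integral_eq_lintegral_ofReal hpi (.of_forall hp0), hp1, ENNReal.ofReal_one]⟩
  have hF : Integrable g.translate ν :=
    (integrable_const ‖g‖).mono' hgt.aestronglyMeasurable
      (.of_forall fun x => g.norm_translate_le x)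
  have hmem : ∫ x, g.translate x ∂ν ∈ closure (convexHull ℝ (isotropicGaussians N)) := by
    refine (convex_convexHull ℝ _).closure.integral_mem isClosed_closure (.of_forall fun x => ?_) hF
    refine subset_closure (subset_convexHull ℝ _ ⟨s, hs, x, fun h => ?_⟩)
    rw [complexGaussianPDF_eq_zero_mean]
    rfl
  convert hmem using 1
  have hν2 : ∫ x, g.translate x ∂ν = ∫ x, p x • g.translate x := by
    rw [integral_withDensity_eq_integral_toReal_smul
      (p.continuous.measurable.ennreal_ofReal) (.of_forall fun _ => ENNReal.ofReal_lt_top)]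
    simp_rw [ENNReal.toReal_ofReal (hp0 _)]
  have hi1 : Integrable fun x => p x • g.translate x :=
    hpi.smul_bdd ‖g‖ hgt.aestronglyMeasurable
      (.of_forall fun x => g.norm_translate_le x)
  have hi2 : Integrable fun u : Fin N → ℂ => complexGaussianPDF 0 1 u • p.translate (s • u) :=
    (integrable_complexGaussianPDF 0 Matrix.PosDef.one).smul_bdd ‖p‖
      (hpt.comp (continuous_const_smul s)).aestronglyMeasurable
      (.of_forall fun x => p.norm_translate_le _)
  rw [hν2]
  ext h
  rw [← BoundedContinuousFunction.evalCLM_apply ℝ h, ← BoundedContinuousFunction.evalCLM_apply ℝ h,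
    ← ContinuousLinearMap.integral_comp_comm _ hi1, ← ContinuousLinearMap.integral_comp_comm _ hi2]
  simp only [BoundedContinuousFunction.evalCLM_apply, BoundedContinuousFunction.coe_smul,
    BoundedContinuousFunction.translate_apply, smul_eq_mul]
  rw [← integral_sub_left_eq_self (fun x => p x * g (h - x)) volume h]
  simp only [sub_sub_cancel]
  -- The substitution `v = s u` in real dimension `2 N` produces `s ^ (-2 N)`, which cancels against
  -- the scaling factor of `g`.
  have hsc := Measure.integral_comp_smul volume (fun v => p (h - v) * g v) s
  have hfr : Module.finrank ℝ (Fin N → ℂ) = 2 * N := by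
    simp [Module.finrank_pi_fintype, mul_comm]
  have hgs : ∀ u, g (s • u) = (s ^ 2)⁻¹ ^ N * complexGaussianPDF 0 1 u := fun u =>
    complexGaussianPDF_noiseCov_eq_scale hs u
  rw [hfr, abs_of_nonneg (by positivity), pow_mul, ← inv_pow, smul_eq_mul] at hsc
  simp_rw [hgs, mul_left_comm _ ((s ^ 2)⁻¹ ^ N)] at hsc
  rw [integral_const_mul] at hsc
  rw [← mul_left_cancel₀ (by positivity) hsc]
  simp_rw [mul_comm]

/-- The smoothed densities tend to `p` in sup norm as `s → 0+`, by dominated convergence for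
function-valued integrals with bound `‖p‖` times the standard Gaussian. -/
theorem mem_closure_convexHull_isotropicGaussians {N : ℕ} {p : (Fin N → ℂ) →ᵇ ℝ}
    (hp : UniformContinuous p) (hp0 : ∀ x, 0 ≤ p x) (hp1 : ∫ x, p x = 1) :
    p ∈ closure (convexHull ℝ (isotropicGaussians N)) := by
  have hpt := BoundedContinuousFunction.continuous_translate hp
  have hφ : Continuous fun u : Fin N → ℂ => complexGaussianPDF 0 1 u :=
    continuous_complexGaussianPDF continuous_const _ continuous_id
  have hlim : Tendsto (fun s : ℝ => ∫ u : Fin N → ℂ, complexGaussianPDF 0 1 u • p.translate (s • u))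
      (𝓝[>] 0) (𝓝 (∫ u : Fin N → ℂ, complexGaussianPDF 0 1 u • p.translate ((0 : ℝ) • u))) := by
    refine tendsto_integral_filter_of_dominated_convergence
      (fun u => complexGaussianPDF 0 1 u * ‖p‖) ?_ ?_ ?_ ?_
    · exact .of_forall fun s =>
        (hφ.smul (hpt.comp (continuous_const_smul s))).aestronglyMeasurable
    · refine .of_forall fun s => .of_forall fun u => ?_
      have := complexGaussianPDF_nonneg (m := 0) Matrix.PosDef.one u
      rw [norm_smul, Real.norm_of_nonneg this]
      exact mul_le_mul_of_nonneg_left (p.norm_translate_le _) this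
    · exact (integrable_complexGaussianPDF 0 Matrix.PosDef.one).mul_const _
    · refine .of_forall fun u => Tendsto.const_smul ?_ _
      have : Continuous fun s : ℝ => p.translate (s • u) := hpt.comp (by fun_prop)
      exact (this.tendsto 0).mono_left nhdsWithin_le_nhds
  have h0 : ∫ u : Fin N → ℂ, complexGaussianPDF 0 1 u • p.translate ((0 : ℝ) • u) = p := by
    have hT : p.translate 0 = p := by
      ext x
      simp [BoundedContinuousFunction.translate_apply]
    simp_rw [zero_smul, hT]
    rw [integral_smul_const, integral_complexGaussianPDF 0 Matrix.PosDef.one, one_smul]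
  rw [h0] at hlim
  refine isClosed_closure.mem_of_tendsto hlim ?_
  filter_upwards [self_mem_nhdsWithin] with s hs
  exact integral_translate_mem_closure hp hp0 hp1 hs

/-! ### From finite mixtures to a sequence of MFAs -/

theorem exists_MFA_of_mem_convexHull {N : ℕ} (L : ℕ) {f : (Fin N → ℂ) →ᵇ ℝ}
    (hf : f ∈ convexHull ℝ (isotropicGaussians N)) :
    ∃ K₀ : ℕ, ∀ K ≥ K₀, ∃ M : MFA N L K, ∀ x, M.density x = f x := by
  obtain ⟨ι, _, w, z, hw0, hw1, hz, rfl⟩ := mem_convexHull_iff_exists_fintype.1 hf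
  choose s hs μ hμ using hz
  refine ⟨Fintype.card ι, fun K hK => ?_⟩
  obtain ⟨e⟩ : Nonempty (ι ↪ Fin K) := Function.Embedding.nonempty_of_card_le (by simpa using hK)
  have hsum : ∀ F : ι → ℝ, ∀ G : Fin K → ℝ, (∀ k, k ∉ Set.range e → G k = 0) →
      (∀ i, F i = G (e i)) → ∑ i, F i = ∑ k, G k := fun F G h0 h =>
    Finset.sum_of_injOn e e.injective.injOn (by simp [Set.MapsTo])
      (fun k _ hk => h0 k (by simpa using hk)) fun i _ => h i
  -- Components outside the range of `e` get weight zero; their uniqueness defaults to `1` so that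
  -- the covariance stays positive definite.
  let M : MFA N L K :=
    { weight := Function.extend e w 0
      mean := Function.extend e μ 0
      loading := 0
      uniqueness := fun k _ => Function.extend e s 1 k ^ 2
      weight_nonneg := fun k => by
        by_cases hk : ∃ i, e i = k
        · obtain ⟨i, rfl⟩ := hk
          rw [e.injective.extend_apply]
          exact hw0 i
        · rw [Function.extend_apply' _ _ _ hk]
          rfl
      weight_sum := by
        rw [← hw1, eq_comm]
        exact hsum _ _ (fun k hk => Function.extend_apply' _ _ _ hk)
          fun i => (e.injective.extend_apply _ _ _).symm
      uniqueness_pos := fun k _ => by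
        by_cases hk : ∃ i, e i = k
        · obtain ⟨i, rfl⟩ := hk
          rw [e.injective.extend_apply]
          have := hs i
          positivity
        · rw [Function.extend_apply' _ _ _ hk]
          simp }
  refine ⟨M, fun x => ?_⟩
  have hcov : ∀ i, M.cov (e i) = noiseCov N (s i) := fun i => by
    simp [MFA.cov, MFA.diagCov, M, noiseCov, e.injective.extend_apply, Matrix.smul_one_eq_diagonal]
  rw [M.density_eq, BoundedContinuousFunction.coe_sum, Finset.sum_apply, eq_comm]
  refine hsum _ _ (fun k hk => ?_) fun i => ?_
  · rw [show M.weight k = 0 from Function.extend_apply' _ _ _ hk, zero_mul]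
  · rw [hcov, show M.weight (e i) = w i from e.injective.extend_apply _ _ _,
      show M.mean (e i) = μ i from e.injective.extend_apply _ _ _,
      ← hμ]
    rfl

theorem nonempty_MFA (N L : ℕ) (K : ℕ+) : Nonempty (MFA N L K) :=
  ⟨{ weight := Pi.single ⟨0, K.pos⟩ 1
     mean := 0
     loading := 0
     uniqueness := 1
     weight_nonneg := fun k => by rw [Pi.single_apply]; split_ifs <;> norm_num
     weight_sum := by simp
     uniqueness_pos := fun _ _ => one_pos }⟩

theorem exists_MFA_tendstoUniformly {N : ℕ} (L : ℕ) {p : (Fin N → ℂ) → ℝ} (hp_cont : Continuous p)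
    (hp_nonneg : ∀ h, 0 ≤ p h) (hp_int : ∫ h, p h = 1)
    (hp_zero : Tendsto p (cocompact (Fin N → ℂ)) (𝓝 0)) :
    ∃ M : (K : ℕ+) → MFA N L K, TendstoUniformly (fun K => (M K).density) p atTop := by
  classical
  obtain ⟨B, hB⟩ := exists_bound_of_tendsto_cocompact hp_cont hp_zero
  have hmem := mem_closure_convexHull_isotropicGaussians
    (p := BoundedContinuousFunction.ofNormedAddCommGroup p hp_cont B hB)
    (hp_cont.uniformContinuous_of_tendsto_cocompact hp_zero) hp_nonneg hp_int
  -- Error at most `1 / n`, written as a product so that `n = 0` holds for every MFA.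
  let P (K n : ℕ) (M : MFA N L K) : Prop := ∀ x, n * |p x - M.density x| ≤ 1
  have happrox : ∀ n : ℕ, ∃ K₀ : ℕ, ∀ K ≥ K₀, ∃ M, P K n M := fun n => by
    obtain ⟨f, hf, hd⟩ := Metric.mem_closure_iff.1 hmem (1 / (n + 1)) (by positivity)
    obtain ⟨K₀, hK₀⟩ := exists_MFA_of_mem_convexHull L hf
    refine ⟨K₀, fun K hK => ?_⟩
    obtain ⟨M, hM⟩ := hK₀ K hK
    refine ⟨M, fun x => ?_⟩
    have h1 : |p x - M.density x| < 1 / (n + 1) := by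
      rw [hM, ← Real.dist_eq]
      exact (BoundedContinuousFunction.dist_coe_le_dist x).trans_lt hd
    rw [lt_div_iff₀ (by positivity)] at h1
    nlinarith [abs_nonneg (p x - M.density x)]
  -- Diagonal choice: for each `K`, an MFA reaching the best precision `n ≤ K` available with `K`
  -- components.
  have hbest : ∀ K : ℕ+, ∃ M : MFA N L K, P K (Nat.findGreatest (fun n => ∃ M, P K n M) K) M :=
    fun K => Nat.findGreatest_spec (P := fun n => ∃ M, P K n M) (Nat.zero_le _)
      ⟨(nonempty_MFA N L K).some, fun x => by simp⟩
  choose M hM using hbest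
  refine ⟨M, Metric.tendstoUniformly_iff.2 fun ε hε => ?_⟩
  obtain ⟨n, hn⟩ := exists_nat_gt (1 / ε)
  obtain ⟨K₀, hK₀⟩ := happrox n
  -- `K ≥ K₀` makes precision `n` attainable and `K ≥ n` puts it within the search range; the `+ 1`
  -- makes the threshold positive.
  filter_upwards [eventually_ge_atTop (⟨max K₀ n + 1, Nat.succ_pos _⟩ : ℕ+)] with K hK x
  have hK' : max K₀ n + 1 ≤ (K : ℕ) := hK
  have hle : n ≤ Nat.findGreatest (fun n => ∃ M, P K n M) K :=
    Nat.le_findGreatest (by omega) (hK₀ K (by omega))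
  have h1 : (n : ℝ) * |p x - (M K).density x| ≤ 1 :=
    le_trans (by gcongr) (hM K x)
  rw [div_lt_iff₀ hε] at hn
  have hn0 : (0 : ℝ) < n := by
    by_contra h
    nlinarith
  rw [Real.dist_eq]
  by_contra hlt
  rw [not_lt] at hlt
  nlinarith

theorem corollary1 (N L : ℕ) (σ : ℝ) (hσ : 0 < σ)
    (p : (Fin N → ℂ) → ℝ) (hp_cont : Continuous p) (hp_nonneg : ∀ h, 0 ≤ p h)
    (hp_int : ∫ h, p h = 1) (hp_zero : Tendsto p (cocompact (Fin N → ℂ)) (𝓝 0)) :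
    -- the conditional mean is well defined for every observation
    (∀ y : Fin N → ℂ, 0 < observationPDF σ p y ∧
      Integrable fun h : Fin N → ℂ => posteriorPDF σ p y h • h) ∧
    -- some sequence of MFA densities with `K` components converges to `p` in the supremum norm
    (∃ M : (K : ℕ+) → MFA N L K, TendstoUniformly (fun K => (M K).density) p atTop) ∧
    -- for every such sequence the estimators converge to the conditional mean, for every `y`
    (∀ M : (K : ℕ+) → MFA N L K, TendstoUniformly (fun K => (M K).density) p atTop →
      ∀ y : Fin N → ℂ,
        Tendsto (fun K : ℕ+ =>
          ‖WithLp.toLp 2 (conditionalMean σ p y - (M K).estimator σ y)‖) atTop (𝓝 0)) := by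
  obtain ⟨B, hB⟩ := exists_bound_of_tendsto_cocompact hp_cont hp_zero
  have hpos := observationPDF_pos hσ hp_cont hB hp_nonneg (by rw [hp_int]; exact one_ne_zero)
  refine ⟨fun y => ⟨hpos y, ?_⟩,
    exists_MFA_tendstoUniformly L hp_cont hp_nonneg hp_int hp_zero, fun M hM y => ?_⟩
  · refine ((integrable_noise_mul_smul hσ hp_cont hB y).smul (observationPDF σ p y)⁻¹).congr
      (.of_forall fun h => ?_)
    simp only [Pi.smul_apply, smul_smul, posteriorPDF, div_eq_inv_mul]
  · have h := tendsto_conditionalMean_of_tendstoUniformly hσ (fun K => (M K).continuous_density)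
      hB hM y (hpos y).ne'
    simp_rw [(M _).estimator_eq_conditionalMean hσ y]
    -- The convergence `h` is in the product topology; continuity of `toLp` transfers it to the
    -- Euclidean norm.
    have hc : Continuous fun v : Fin N → ℂ => ‖WithLp.toLp 2 (conditionalMean σ p y - v)‖ :=
      ((PiLp.continuous_toLp 2 _).comp (continuous_const.sub continuous_id)).norm
    have := (hc.tendsto _).comp h
    rwa [sub_self, WithLp.toLp_zero, norm_zero] at this
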